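/- Let $R$ be a domain, i.e. an associative, not necessarily commutative, nonzero ring with $1$ and without zero divisors. A unary pp formula for left $R$-modules is a formula $\varphi(x)=\exists\bar y\,(A\bar y = b x)$ with $A$ an $m\times k$ matrix and $b$ a column of length $m$ over $R$; in a left module $M$ it defines the subgroup $\varphi(M)=\{x\in M : A\bar y=bx \text{ for some } \bar y\in M^k\}$. A module $M$ is absolutely pure if it is pure in every module $N$ containing it, i.e. $\varphi(M)=M\cap\varphi(N)$ for all unary pp formulas $\varphi$; it is called flat-sharp if it is nonzero, flat and absolutely pure. A unary pp formula $\varphi$ is called high if $\varphi(N)=N$ for every absolutely pure module $N$; low if $\varphi(F)=0$ for every flat module $F$; bounded if there is $0\ne r\in R$ with $r\varphi(M)=0$ for all modules $M$; cobounded if there is $0\neq s\in R$ with $sM\subseteq\varphi(M)$ for all modules $M$. The analogous notions for right modules are defined symmetrically. ${\rm E}(-)$ denotes the injective hull. The following are equivalent. (i) $R$ is two-sided Ore: $Ra\cap Rb\neq 0$ and $aR\cap bR\ne 0$ for all nonzero $a,b\in R$. (ii) The left module ${\rm E}({}_RR)$ is flat. (iii) The right module ${\rm E}(R_R)$ is flat.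 (iv) There is a flat-sharp left $R$-module or a flat-sharp right $R$-module. (v) There are both a flat-sharp left $R$-module and a flat-sharp right $R$-module. (vi) There is no unary pp formula, for left or for right modules, that is both high and low. (vii) Both for left and for right modules, the unary pp formulas are partitioned into the region of formulas that are high and cobounded, which contains every divisibility formula $r\mid x$ with $0\neq r\in R$, and the region of formulas that are low and bounded, which contains every annihilation formula $rx=0$ with $0\ne r\in R$ (with scalars on the other side, $xr=0$, for right modules). Moreover, if ${\rm E}({}_RR)$ is flat then it is flat-sharp, and if ${\rm E}(R_R)$ is flat then it is flat-sharp. -/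

import Mathlib

/-! Left modules over a ring `S` are Mathlib modules over `S`; right `R`-modules are modules over
`Rᵐᵒᵖ`.  All notions below are stated for left modules over an arbitrary ring and are used for right
`R`-modules by taking that ring to be `Rᵐᵒᵖ`. -/

namespace PPMod

open scoped TensorProduct

universe u

section Tensor

variable (R : Type u) [Ring R]

/-- The relations `(a r) ⊗ m = a ⊗ (r m)` that turn `A ⊗_ℤ M` into `A ⊗_R M`. -/
def balancedRel (A : Type u) [AddCommGroup A] [Module Rᵐᵒᵖ A]
    (M : Type u) [AddCommGroup M] [Module R M] : AddSubgroup (A ⊗[ℤ] M) :=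
  AddSubgroup.closure
    {t | ∃ (a : A) (r : R) (m : M), t = (MulOpposite.op r • a) ⊗ₜ[ℤ] m - a ⊗ₜ[ℤ] (r • m)}

/-- The abelian group `A ⊗_R M` for a right module `A` and a left module `M` over a
(noncommutative) ring `R`. -/
abbrev BalancedTensor (A : Type u) [AddCommGroup A] [Module Rᵐᵒᵖ A]
    (M : Type u) [AddCommGroup M] [Module R M] : Type u :=
  (A ⊗[ℤ] M) ⧸ balancedRel R A M

theorem balancedRel_le_comap {A B : Type u} [AddCommGroup A] [Module Rᵐᵒᵖ A]
    [AddCommGroup B] [Module Rᵐᵒᵖ B] (M : Type u) [AddCommGroup M] [Module R M]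
    (f : A →ₗ[Rᵐᵒᵖ] B) :
    balancedRel R A M ≤ (balancedRel R B M).comap
      (LinearMap.rTensor M f.toAddMonoidHom.toIntLinearMap).toAddMonoidHom := by
  refine (AddSubgroup.closure_le _).2 ?_
  rintro _ ⟨a, r, m, rfl⟩
  refine AddSubgroup.subset_closure ⟨f a, r, m, ?_⟩
  simp

/-- The map `f ⊗ M : A ⊗_R M → B ⊗_R M`. -/
def BalancedTensor.map {A B : Type u} [AddCommGroup A] [Module Rᵐᵒᵖ A]
    [AddCommGroup B] [Module Rᵐᵒᵖ B] (M : Type u) [AddCommGroup M] [Module R M]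
    (f : A →ₗ[Rᵐᵒᵖ] B) : BalancedTensor R A M →+ BalancedTensor R B M :=
  QuotientAddGroup.map _ _
    (LinearMap.rTensor M f.toAddMonoidHom.toIntLinearMap).toAddMonoidHom
    (balancedRel_le_comap R M f)

/-- A left module `M` is flat if `- ⊗_R M` preserves injectivity of maps of right modules. -/
def IsFlat (M : Type u) [AddCommGroup M] [Module R M] : Prop :=
  ∀ (A B : Type u) [AddCommGroup A] [Module Rᵐᵒᵖ A] [AddCommGroup B] [Module Rᵐᵒᵖ B]
    (f : A →ₗ[Rᵐᵒᵖ] B), Function.Injective f → Function.Injective (BalancedTensor.map R M f)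

end Tensor

section Hull

variable {R : Type u} [Ring R]

/-- `i : M → E` is an injective hull: an essential embedding into an injective module. -/
structure IsInjectiveHull {M E : Type u} [AddCommGroup M] [Module R M]
    [AddCommGroup E] [Module R E] (i : M →ₗ[R] E) : Prop where
  embedding : Function.Injective i
  essential : ∀ N : Submodule R E, N ⊓ LinearMap.range i = ⊥ → N = ⊥
  injective : Module.Injective R E

/-- A maximal essential extension of `L` inside an injective module is injective. -/
theorem exists_injective_essential {J : Type u} [AddCommGroup J] [Module R J]
    [hJ : Module.Injective R J] (L : Submodule R J) :
    ∃ E : Submodule R J, L ≤ E ∧ (∀ N ≤ E, N ⊓ L = ⊥ → N = ⊥) ∧ Module.Injective R E := by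
  obtain ⟨E, hLE, hE⟩ := zorn_le_nonempty₀
    {E : Submodule R J | L ≤ E ∧ ∀ N ≤ E, N ⊓ L = ⊥ → N = ⊥}
    (fun c hc hchain y hy => by
      refine ⟨sSup c, ⟨(hc hy).1.trans (le_sSup hy), fun N hN hNL => ?_⟩,
        fun z hz => le_sSup hz⟩
      refine (Submodule.eq_bot_iff _).2 fun x hx => ?_
      obtain ⟨z, hz, hxz⟩ := (Submodule.mem_sSup_of_directed ⟨y, hy⟩ hchain.directedOn).1 (hN hx)
      have h1 : Submodule.span R {x} = ⊥ := by
        refine (hc hz).2 _ ((Submodule.span_singleton_le_iff_mem _ _).2 hxz) ?_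
        refine eq_bot_iff.2 (le_trans (inf_le_inf_right _ ?_) hNL.le)
        exact (Submodule.span_singleton_le_iff_mem _ _).2 hx
      exact Submodule.span_singleton_eq_bot.1 h1)
    L ⟨le_rfl, fun N hN hNL => by rwa [inf_eq_left.2 hN] at hNL⟩
  obtain ⟨⟨hLE, hEss⟩, hmax⟩ := hE
  obtain ⟨C, -, hC⟩ := zorn_le_nonempty₀ {C : Submodule R J | C ⊓ E = ⊥}
    (fun c hc hchain y hy => by
      refine ⟨sSup c, (Submodule.eq_bot_iff _).2 fun x hx => ?_, fun z hz => le_sSup hz⟩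
      obtain ⟨z, hz, hxz⟩ := (Submodule.mem_sSup_of_directed ⟨y, hy⟩ hchain.directedOn).1 hx.1
      exact (Submodule.eq_bot_iff _).1 (hc hz) x ⟨hxz, hx.2⟩)
    ⊥ (by simp)
  obtain ⟨hCE, hCmax⟩ := hC
  have hCE' : C ⊓ E = ⊥ := hCE
  -- `E` embeds in `J ⧸ C`
  have hinj : Function.Injective (C.mkQ ∘ₗ E.subtype) := by
    rw [← LinearMap.ker_eq_bot, Submodule.eq_bot_iff]
    intro x hx
    have hxC : (x : J) ∈ C := by simpa using hx
    exact Subtype.ext ((Submodule.eq_bot_iff _).1 hCE' x ⟨hxC, x.2⟩)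
  obtain ⟨g, hg⟩ := hJ.out (C.mkQ ∘ₗ E.subtype) hinj E.subtype
  -- the composite `J → J ⧸ C → J` is the identity on `E`
  let h : J →ₗ[R] J := g ∘ₗ C.mkQ
  have hid : ∀ x : E, h x = x := fun x => hg x
  have hker : LinearMap.ker h = C := by
    refine (hCmax ?_ ?_).antisymm ?_
    · refine (Submodule.eq_bot_iff _).2 fun x hx => ?_
      have := hid ⟨x, hx.2⟩
      rw [show h x = 0 from hx.1] at this
      exact this.symm
    · intro x hx
      have : C.mkQ x = 0 := by simpa using hx
      simp [h, this]
    · intro x hx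
      have : C.mkQ x = 0 := by simpa using hx
      simp [h, this]
  have hEr : E ≤ LinearMap.range h := fun x hx => ⟨x, hid ⟨x, hx⟩⟩
  have hrE : LinearMap.range h ≤ E := by
    refine hmax ⟨hLE.trans hEr, fun N hN hNL => ?_⟩ hEr
    have hNE : N ⊓ E = ⊥ := hEss _ inf_le_right (by
      rw [inf_assoc, inf_eq_right.2 hLE, hNL])
    -- the preimage of `N` misses `E`, so it is `C`
    have hpre : N.comap h ⊓ E = ⊥ := by
      refine (Submodule.eq_bot_iff _).2 fun x hx => ?_
      have h1 : h x ∈ N := hx.1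
      rw [hid ⟨x, hx.2⟩] at h1
      exact (Submodule.eq_bot_iff _).1 hNE x ⟨h1, hx.2⟩
    have hle : N.comap h ≤ C := hCmax hpre (by
      rw [← hker]
      intro x hx
      have : h x = 0 := hx
      simp [this])
    refine (Submodule.eq_bot_iff _).2 fun x hx => ?_
    obtain ⟨y, rfl⟩ := hN hx
    have : y ∈ LinearMap.ker h := hker ▸ hle hx
    exact this
  refine ⟨E, hLE, hEss, ⟨fun X Y _ _ _ _ f hf k => ?_⟩⟩
  obtain ⟨l, hl⟩ := hJ.out f hf (E.subtype ∘ₗ k)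
  refine ⟨(h.codRestrict E fun x => hrE ⟨x, rfl⟩) ∘ₗ l, fun x => ?_⟩
  refine Subtype.ext ?_
  have : l (f x) = (k x : J) := hl x
  simp [this, hid]

theorem exists_isInjectiveHull (R : Type u) [Ring R] (M : Type u) [AddCommGroup M] [Module R M] :
    ∃ (E : ModuleCat.{u} R) (i : M →ₗ[R] E), IsInjectiveHull i := by
  obtain ⟨P⟩ := CategoryTheory.EnoughInjectives.presentation (ModuleCat.of R M)
  have hPo : CategoryTheory.Injective (ModuleCat.of R P.J) := P.injective
  have hPi : Module.Injective R P.J := Module.injective_module_of_injective_object R P.J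
  have hPm : Function.Injective P.f.hom := (ModuleCat.mono_iff_injective _).1 inferInstance
  let f : M →ₗ[R] P.J := P.f.hom
  obtain ⟨E, hLE, hEss, hE⟩ := exists_injective_essential (LinearMap.range f)
  refine ⟨ModuleCat.of R E, f.codRestrict E fun x => hLE ⟨x, rfl⟩, ?_, ?_, hE⟩
  · intro x y hxy
    exact hPm (congrArg Subtype.val hxy)
  · intro N hN
    have h1 : N.map E.subtype = ⊥ := by
      refine hEss _ (by rintro _ ⟨x, -, rfl⟩; exact x.2) ?_
      refine (Submodule.eq_bot_iff _).2 ?_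
      rintro _ ⟨⟨x, hx, rfl⟩, ⟨m, hm⟩⟩
      have : x ∈ N ⊓ LinearMap.range (f.codRestrict E fun x => hLE ⟨x, rfl⟩) :=
        ⟨hx, m, Subtype.ext hm⟩
      rw [hN] at this
      have h0 : x = 0 := this
      simp [h0]
    refine (Submodule.eq_bot_iff _).2 fun x hx => Subtype.ext ?_
    exact (Submodule.eq_bot_iff _).1 h1 _ ⟨x, hx, rfl⟩

/-- `E(M)`, the injective hull of the module `M`. -/
noncomputable def InjectiveHull (R : Type u) [Ring R] (M : Type u) [AddCommGroup M] [Module R M] :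
    ModuleCat.{u} R :=
  (exists_isInjectiveHull R M).choose

end Hull

/-- A unary pp formula `∃ ȳ (A ȳ = b x)` for left modules over `R`, where `A` is an `m × k` matrix
and `b` a column of length `m` over `R`.  Over `Rᵐᵒᵖ` this is a unary pp formula
`∃ ȳ (ȳ C = x d)` for right `R`-modules. -/
structure PPFormula (R : Type u) where
  m : ℕ
  k : ℕ
  A : Matrix (Fin m) (Fin k) R
  b : Fin m → R

namespace PPFormula

variable {R : Type u} [Ring R]

/-- The pp subgroup `φ(M)` defined by `φ` in `M`. -/
def eval (φ : PPFormula R) (M : Type u) [AddCommGroup M] [Module R M] : AddSubgroup M where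
  carrier := {x | ∃ y : Fin φ.k → M, ∀ i, ∑ j, φ.A i j • y j = φ.b i • x}
  zero_mem' := ⟨0, by simp⟩
  add_mem' := by
    rintro x x' ⟨y, hy⟩ ⟨y', hy'⟩
    exact ⟨y + y', fun i => by simp [smul_add, Finset.sum_add_distrib, hy, hy']⟩
  neg_mem' := by
    rintro x ⟨y, hy⟩
    exact ⟨-y, fun i => by simp [hy]⟩

/-- The divisibility formula `r | x`. -/
def dvd (r : R) : PPFormula R := ⟨1, 1, fun _ _ => r, fun _ => 1⟩

/-- The annihilation formula `r x = 0`. -/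
def ann (r : R) : PPFormula R := ⟨1, 0, fun _ j => j.elim0, fun _ => r⟩

end PPFormula

section Regions

variable (R : Type u) [Ring R]

/-- `M` is absolutely pure: it is pure in every extension, i.e. `φ(M) = M ∩ φ(N)` for every
embedding of `M` in a module `N` and every unary pp formula `φ`. -/
def IsAbsolutelyPure (M : Type u) [AddCommGroup M] [Module R M] : Prop :=
  ∀ (N : Type u) [AddCommGroup N] [Module R N] (f : M →ₗ[R] N), Function.Injective f →
    ∀ (φ : PPFormula R) (x : M), x ∈ φ.eval M ↔ f x ∈ φ.eval N

/-- A flat-sharp module: nonzero, flat and absolutely pure. -/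
def IsFlatSharp (M : Type u) [AddCommGroup M] [Module R M] : Prop :=
  Nontrivial M ∧ IsFlat R M ∧ IsAbsolutelyPure R M

/-- There is a flat-sharp (left) module over `R`. -/
def HasFlatSharp : Prop :=
  ∃ M : ModuleCat.{u} R, IsFlatSharp R M

variable {R}

/-- `φ(N) = N` for all absolutely pure `N`. -/
def PPFormula.IsHigh (φ : PPFormula R) : Prop :=
  ∀ (N : Type u) [AddCommGroup N] [Module R N], IsAbsolutelyPure R N → φ.eval N = ⊤

/-- `φ(F) = 0` for all flat `F`. -/
def PPFormula.IsLow (φ : PPFormula R) : Prop :=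
  ∀ (F : Type u) [AddCommGroup F] [Module R F], IsFlat R F → φ.eval F = ⊥

/-- A single nonzero scalar annihilates `φ(M)` for all `M`. -/
def PPFormula.IsBounded (φ : PPFormula R) : Prop :=
  ∃ r : R, r ≠ 0 ∧ ∀ (M : Type u) [AddCommGroup M] [Module R M], ∀ x ∈ φ.eval M, r • x = 0

/-- A single nonzero scalar sends `M` into `φ(M)` for all `M`. -/
def PPFormula.IsCobounded (φ : PPFormula R) : Prop :=
  ∃ s : R, s ≠ 0 ∧ ∀ (M : Type u) [AddCommGroup M] [Module R M], ∀ x : M, s • x ∈ φ.eval M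

variable (R)

/-- The lattice of unary pp formulas for left `R`-modules is partitioned into the region of
formulas that are high and cobounded, which contains all `r | x` with `r ≠ 0`, and the region of
formulas that are low and bounded, which contains all `r x = 0` with `r ≠ 0`. -/
def HasTwoRegions : Prop :=
  (∀ φ : PPFormula R,
    ((φ.IsHigh ∧ φ.IsCobounded) ∨ (φ.IsLow ∧ φ.IsBounded)) ∧
    ¬ ((φ.IsHigh ∧ φ.IsCobounded) ∧ (φ.IsLow ∧ φ.IsBounded))) ∧
  (∀ r : R, r ≠ 0 →
    ((PPFormula.dvd r).IsHigh ∧ (PPFormula.dvd r).IsCobounded) ∧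
    ((PPFormula.ann r).IsLow ∧ (PPFormula.ann r).IsBounded))

end Regions

section Ore

variable (R : Type u) [Ring R]

/-- `Ra ∩ Rb ≠ 0` for all nonzero `a`, `b`. -/
def IsLeftOre : Prop :=
  ∀ a b : R, a ≠ 0 → b ≠ 0 → ∃ c d : R, c * a = d * b ∧ c * a ≠ 0

/-- `aR ∩ bR ≠ 0` for all nonzero `a`, `b`. -/
def IsRightOre : Prop :=
  ∀ a b : R, a ≠ 0 → b ≠ 0 → ∃ c d : R, a * c = b * d ∧ a * c ≠ 0

end Ore

end PPMod

/-! A flat-sharp module is nonzero and sees a high formula as everything and a low one as zero, so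
no formula is both. If left Ore fails for a, b, then Ra + Rb is free on a and b, and `∃ y (a y = x ∧
b y = 0)` is high and low; if right Ore fails, `∃ z (b z = a x)` is. Both are formulas for left
modules, so a flat-sharp module on one side already yields both Ore conditions. Conversely, let R be
two-sided Ore. The torsion of E(R) is a submodule missing R, hence zero, so nonzero scalars act
bijectively on E(R); over a right Ore domain such a module is flat
(`IsRightOre.isFlat_of_bijective_smul`). For the two regions, Ore elimination
(`exists_solution_or_obstruction`) gives either A c = b s with s ≠ 0, whence sM ⊆ φ(M), or a row p
with pA = 0 and pb ≠ 0, whence pb kills φ(M). -/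

namespace PPMod

open scoped TensorProduct

universe u

/-! ### Flatness: linear relations, and the character module criterion. -/

section Tensor

variable {R : Type u} [Ring R]

/-- A balanced biadditive map `A × M → P` induces a map `A ⊗_R M → P`. -/
noncomputable def BalancedTensor.lift {A M P : Type u} [AddCommGroup A] [Module Rᵐᵒᵖ A]
    [AddCommGroup M] [Module R M] [AddCommGroup P] (g : A →+ M →+ P)
    (hg : ∀ (a : A) (r : R) (m : M), g (MulOpposite.op r • a) m = g a (r • m)) :
    BalancedTensor R A M →+ P :=
  QuotientAddGroup.lift _
    (TensorProduct.liftAddHom (R := ℤ) g fun n a m => by simp) (by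
      refine (AddSubgroup.closure_le _).2 ?_
      rintro _ ⟨a, r, m, rfl⟩
      simp [hg])

theorem BalancedTensor.mk_op_smul_tmul {A M : Type u} [AddCommGroup A] [Module Rᵐᵒᵖ A]
    [AddCommGroup M] [Module R M] (a : A) (r : R) (m : M) :
    (QuotientAddGroup.mk ((MulOpposite.op r • a) ⊗ₜ[ℤ] m) : BalancedTensor R A M) =
      QuotientAddGroup.mk (a ⊗ₜ[ℤ] (r • m)) := by
  rw [← sub_eq_zero, ← QuotientAddGroup.mk_sub, QuotientAddGroup.eq_zero_iff]
  exact AddSubgroup.subset_closure ⟨a, r, m, rfl⟩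

/-- The multiplication map `R ⊗_R M → M`. -/
noncomputable def BalancedTensor.smulHom (M : Type u) [AddCommGroup M] [Module R M] :
    BalancedTensor R R M →+ M :=
  BalancedTensor.lift (smulAddHom R M) fun a r m => by simp [mul_smul]

/-- A flat module satisfies no linear relation with coefficients that are right linearly
independent. -/
theorem IsFlat.eq_zero_of_smul_eq_smul {F : Type u} [AddCommGroup F] [Module R F]
    (hF : IsFlat R F) {a b : R} (hab : ∀ c d : R, a * c = b * d → c = 0 ∧ d = 0)
    {x z : F} (h : a • x = b • z) : x = 0 ∧ z = 0 := by
  let f : R × R →ₗ[Rᵐᵒᵖ] R :=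
    { toFun := fun p => a * p.1 - b * p.2
      map_add' := fun p q => by simp only [Prod.fst_add, Prod.snd_add]; noncomm_ring
      map_smul' := fun r p => by simp [sub_mul, mul_assoc] }
  have hf : Function.Injective f := by
    rw [injective_iff_map_eq_zero]
    rintro ⟨c, d⟩ hcd
    have := hab c d (sub_eq_zero.1 hcd)
    exact Prod.ext this.1 this.2
  let t : BalancedTensor R (R × R) F :=
    QuotientAddGroup.mk (((1 : R), (0 : R)) ⊗ₜ[ℤ] x + ((0 : R), (1 : R)) ⊗ₜ[ℤ] z)
  have ht : t = 0 := by
    apply hF _ _ f hf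
    rw [map_zero]
    have h1 : BalancedTensor.map R F f t =
        QuotientAddGroup.mk (a ⊗ₜ[ℤ] x) + QuotientAddGroup.mk ((-b) ⊗ₜ[ℤ] z) := by
      change QuotientAddGroup.mk (LinearMap.rTensor F f.toAddMonoidHom.toIntLinearMap
        (((1 : R), (0 : R)) ⊗ₜ[ℤ] x + ((0 : R), (1 : R)) ⊗ₜ[ℤ] z)) = _
      rw [← QuotientAddGroup.mk_add]
      simp [f]
    have h2 : ∀ (r : R) (y : F), (QuotientAddGroup.mk (r ⊗ₜ[ℤ] y) : BalancedTensor R R F) =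
        QuotientAddGroup.mk ((1 : R) ⊗ₜ[ℤ] (r • y)) := fun r y => by
      rw [← BalancedTensor.mk_op_smul_tmul]; simp
    rw [h1, h2 a, h2 (-b), ← QuotientAddGroup.mk_add, ← TensorProduct.tmul_add]
    simp [h]
  -- Every functional on R² sends `t = 0` to zero; the two projections isolate x and z.
  have key : ∀ p : R × R →ₗ[Rᵐᵒᵖ] R, p (1, 0) • x + p (0, 1) • z = 0 := fun p => by
    have h3 : BalancedTensor.smulHom F (BalancedTensor.map R F p t) =
      p (1, 0) • x + p (0, 1) • z := rfl
    rw [← h3, ht, map_zero, map_zero]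
  refine ⟨?_, ?_⟩
  · simpa using key (LinearMap.fst Rᵐᵒᵖ R R)
  · simpa using key (LinearMap.snd Rᵐᵒᵖ R R)

/-- Left multiplication by b is injective on R as a right module; tensored with F it becomes the
action of b. -/
theorem IsFlat.eq_zero_of_smul_eq_zero [IsDomain R] {F : Type u} [AddCommGroup F] [Module R F]
    (hF : IsFlat R F) {b : R} (hb : b ≠ 0) {y : F} (h : b • y = 0) : y = 0 := by
  let f : R →ₗ[Rᵐᵒᵖ] R :=
    { toFun := fun p => b * p
      map_add' := fun p q => mul_add _ _ _
      map_smul' := fun r p => by simp [mul_assoc] }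
  let t : BalancedTensor R R F := QuotientAddGroup.mk ((1 : R) ⊗ₜ[ℤ] y)
  have ht : t = 0 := by
    apply hF _ _ f (mul_right_injective₀ hb)
    rw [map_zero]
    have h1 : BalancedTensor.map R F f t =
        QuotientAddGroup.mk ((MulOpposite.op b • (1 : R)) ⊗ₜ[ℤ] y) := by
      change QuotientAddGroup.mk (LinearMap.rTensor F f.toAddMonoidHom.toIntLinearMap
        ((1 : R) ⊗ₜ[ℤ] y)) = _
      simp [f]
    rw [h1, BalancedTensor.mk_op_smul_tmul, h]
    simp
  have h3 : BalancedTensor.smulHom F t = (1 : R) • y := rfl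
  rw [← one_smul R y, ← h3, ht, map_zero]

/-- `Hom_ℤ(M, ℚ/ℤ)`, a right module for a left module `M`. -/
def CharModule (M : Type u) [AddCommGroup M] : Type u := M →+ AddCircle (1 : ℚ)

noncomputable instance (M : Type u) [AddCommGroup M] : AddCommGroup (CharModule M) :=
  inferInstanceAs (AddCommGroup (M →+ AddCircle (1 : ℚ)))

noncomputable instance (M : Type u) [AddCommGroup M] [Module R M] :
    Module Rᵐᵒᵖ (CharModule M) where
  smul r χ := AddMonoidHom.comp χ (DistribSMul.toAddMonoidHom M r.unop)
  one_smul χ := AddMonoidHom.ext fun m => congrArg (DFunLike.coe (F := M →+ _) χ) (one_smul R m)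
  mul_smul r s χ := AddMonoidHom.ext fun m =>
    congrArg (DFunLike.coe (F := M →+ _) χ) (mul_smul s.unop r.unop m)
  smul_zero _ := rfl
  smul_add _ _ _ := rfl
  add_smul r s χ := AddMonoidHom.ext fun m =>
    (congrArg (DFunLike.coe (F := M →+ _) χ) (add_smul r.unop s.unop m)).trans
      (AddMonoidHom.map_add χ _ _)
  zero_smul χ := AddMonoidHom.ext fun m =>
    (congrArg (DFunLike.coe (F := M →+ _) χ) (zero_smul R m)).trans (AddMonoidHom.map_zero χ)

/-- The underlying character of an element of the character module. -/
noncomputable def CharModule.toHom (M : Type u) [AddCommGroup M] :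
    CharModule M →+ M →+ AddCircle (1 : ℚ) := AddMonoidHom.id _

theorem CharModule.toHom_smul (M : Type u) [AddCommGroup M] [Module R M] (r : Rᵐᵒᵖ)
    (χ : CharModule M) (m : M) :
    CharModule.toHom M (r • χ) m = CharModule.toHom M χ (r.unop • m) := rfl

theorem CharModule.ext {M : Type u} [AddCommGroup M] {χ ψ : CharModule M}
    (h : ∀ m, CharModule.toHom M χ m = CharModule.toHom M ψ m) : χ = ψ := AddMonoidHom.ext h

/-- A module with injective character module is flat. -/
theorem isFlat_of_injective_charModule {M : Type u} [AddCommGroup M] [Module R M]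
    (hM : Module.Injective Rᵐᵒᵖ (CharModule M)) : IsFlat R M := by
  intro A B _ _ _ _ f hf
  rw [injective_iff_map_eq_zero]
  intro t ht
  by_contra ht0
  obtain ⟨c, hc⟩ := CharacterModule.exists_character_apply_ne_zero_of_ne_zero ht0
  let c' : BalancedTensor R A M →+ AddCircle (1 : ℚ) := c
  let mkA : A ⊗[ℤ] M →+ BalancedTensor R A M := QuotientAddGroup.mk' _
  -- By tensor-hom adjunction `c` is a map `A → CharModule M`; extending it to `B` factors `c`
  -- through `f ⊗ M`, so `ht` forces `c t = 0`.
  let g : A →ₗ[Rᵐᵒᵖ] CharModule M :=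
    { toFun := fun a => (c'.comp mkA).comp (TensorProduct.mk ℤ A M a).toAddMonoidHom
      map_add' := fun a b => AddMonoidHom.ext fun m =>
        (congrArg (c'.comp mkA) (TensorProduct.add_tmul a b m)).trans (map_add _ _ _)
      map_smul' := fun r a => AddMonoidHom.ext fun m =>
        congrArg c' (BalancedTensor.mk_op_smul_tmul a r.unop m) }
  obtain ⟨h, hh⟩ := hM.out f hf g
  let h' : B →+ M →+ AddCircle (1 : ℚ) := (CharModule.toHom M).comp h.toAddMonoidHom
  let l : B ⊗[ℤ] M →+ AddCircle (1 : ℚ) :=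
    TensorProduct.liftAddHom (R := ℤ) h' fun n a m => by simp
  have hl : balancedRel R B M ≤ l.ker := by
    refine (AddSubgroup.closure_le _).2 ?_
    rintro _ ⟨b, r, m, rfl⟩
    have : h' (MulOpposite.op r • b) m = h' b (r • m) :=
      (congrArg (fun χ => CharModule.toHom M χ m) (h.map_smul (MulOpposite.op r) b)).trans rfl
    simp [l, this]
  let d : BalancedTensor R B M →+ AddCircle (1 : ℚ) := QuotientAddGroup.lift _ l hl
  have hcd : ∀ s, d (BalancedTensor.map R M f s) = c' s := by
    intro s
    induction s using QuotientAddGroup.induction_on with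
    | H s =>
      induction s using TensorProduct.induction_on with
      | zero => exact (map_zero (d.comp (BalancedTensor.map R M f))).trans (map_zero c').symm
      | tmul a m => exact congrArg (fun χ => CharModule.toHom M χ m) (hh a)
      | add s s' hs hs' => rw [QuotientAddGroup.mk_add, map_add, map_add, map_add, hs, hs']
  exact hc ((hcd t).symm.trans (by rw [ht, map_zero]))

/-- Over a right Ore domain, a module on which all nonzero scalars act bijectively is flat. -/
theorem IsRightOre.isFlat_of_bijective_smul [IsDomain R] (hR : IsRightOre R) {M : Type u}
    [AddCommGroup M] [Module R M]
    (hM : ∀ s : R, s ≠ 0 → Function.Bijective fun m : M => s • m) : IsFlat R M := by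
  refine isFlat_of_injective_charModule (Module.Baer.injective fun I g => ?_)
  by_cases hI : I = ⊥
  · subst hI
    refine ⟨0, fun x hx => ?_⟩
    have : (⟨x, hx⟩ : (⊥ : Ideal Rᵐᵒᵖ)) = 0 := Subsingleton.elim _ _
    rw [this, map_zero, LinearMap.zero_apply]
  obtain ⟨s, hsI, hs⟩ := Submodule.exists_mem_ne_zero_of_ne_bot hI
  have hs' : s.unop ≠ 0 := fun h => hs (MulOpposite.unop_injective h)
  let e : M ≃+ M := AddEquiv.ofBijective (DistribSMul.toAddMonoidHom M s.unop) (hM _ hs')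
  -- Dividing g(s) by one nonzero s of the ideal gives the only candidate for an extension of g.
  let χ : CharModule M := (CharModule.toHom M (g ⟨s, hsI⟩)).comp e.symm.toAddMonoidHom
  have hχ : s • χ = g ⟨s, hsI⟩ := CharModule.ext fun m =>
    congrArg (CharModule.toHom M (g ⟨s, hsI⟩)) (e.symm_apply_apply m)
  refine ⟨LinearMap.toSpanSingleton Rᵐᵒᵖ _ χ, fun x hx => ?_⟩
  by_cases hx0 : x = 0
  · subst hx0
    have : (⟨0, hx⟩ : I) = 0 := rfl
    rw [this, map_zero, map_zero]
  have hx' : x.unop ≠ 0 := fun h => hx0 (MulOpposite.unop_injective h)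
  -- A common multiple of x and s shows that g(x) and xχ agree after multiplication by c;
  -- surjectivity of c on M then cancels c.
  obtain ⟨c, d, hcd, hc⟩ := hR _ _ hx' hs'
  have hc0 : c ≠ 0 := right_ne_zero_of_mul hc
  have hop : MulOpposite.op c * x = MulOpposite.op d * s := MulOpposite.unop_injective hcd
  have hg : MulOpposite.op c • g ⟨x, hx⟩ = MulOpposite.op c • (x • χ) := by
    rw [← mul_smul, hop, mul_smul, hχ, ← map_smul, ← map_smul]
    exact congrArg g (Subtype.ext hop)
  refine CharModule.ext fun m => ?_
  obtain ⟨m', rfl⟩ := (hM c hc0).2 m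
  exact (congrArg (fun ψ => CharModule.toHom M ψ m') hg).symm

end Tensor

/-! ### Absolute purity, divisibility, and high, low, bounded, cobounded formulas. -/

section Pure

variable {R : Type u} [Ring R]

theorem PPFormula.map_mem_eval (φ : PPFormula R) {M N : Type u} [AddCommGroup M] [Module R M]
    [AddCommGroup N] [Module R N] (f : M →ₗ[R] N) {x : M} (hx : x ∈ φ.eval M) :
    f x ∈ φ.eval N := by
  obtain ⟨y, hy⟩ := hx
  exact ⟨fun j => f (y j), fun i => by simp only [← map_smul, ← map_sum, hy]⟩

theorem isAbsolutelyPure_of_injective {J : Type u} [AddCommGroup J] [Module R J]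
    (hJ : Module.Injective R J) : IsAbsolutelyPure R J := by
  intro N _ _ f hf φ x
  refine ⟨fun hx => φ.map_mem_eval f hx, fun hx => ?_⟩
  obtain ⟨g, hg⟩ := hJ.out f hf LinearMap.id
  have := φ.map_mem_eval g hx
  rwa [hg] at this

/-- A formula is high as soon as it defines the whole module in all injective modules. -/
theorem PPFormula.isHigh_of_injective {φ : PPFormula R}
    (h : ∀ (J : Type u) [AddCommGroup J] [Module R J], Module.Injective R J → φ.eval J = ⊤) :
    φ.IsHigh := by
  intro N _ _ hN
  obtain ⟨E, i, hi⟩ := exists_isInjectiveHull R N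
  refine (AddSubgroup.eq_top_iff' _).2 fun x => (hN E i hi.embedding φ x).2 ?_
  rw [h E hi.injective]
  trivial

/-- Rs is free on s, so s ↦ x extends to R → J; y is the image of 1. -/
theorem exists_smul_eq_of_injective [IsDomain R] {J : Type u} [AddCommGroup J] [Module R J]
    (hJ : Module.Injective R J) {s : R} (hs : s ≠ 0) (x : J) : ∃ y : J, s • y = x := by
  obtain ⟨h, hh⟩ := hJ.out (LinearMap.toSpanSingleton R R s)
    (fun a b hab => mul_left_injective₀ hs hab) (LinearMap.toSpanSingleton R J x)
  refine ⟨h 1, ?_⟩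
  have := hh 1
  simp only [LinearMap.toSpanSingleton_apply, one_smul] at this
  rw [← this, ← map_smul, smul_eq_mul, mul_one]

theorem PPFormula.smul_mem_eval_dvd {M : Type u} [AddCommGroup M] [Module R M] (r : R) (y : M) :
    r • y ∈ (PPFormula.dvd r).eval M :=
  ⟨fun _ => y, fun _ =>
    (Fin.sum_univ_one (fun _ : Fin 1 => r • y)).trans (one_smul R (r • y)).symm⟩

theorem PPFormula.smul_eq_zero_of_mem_eval_ann {M : Type u} [AddCommGroup M] [Module R M] {r : R}
    {x : M} (hx : x ∈ (PPFormula.ann r).eval M) : r • x = 0 :=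
  let ⟨_, hy⟩ := hx
  (hy (0 : Fin 1)).symm

theorem PPFormula.IsCobounded.isHigh [IsDomain R] {φ : PPFormula R} (h : φ.IsCobounded) :
    φ.IsHigh := by
  obtain ⟨s, hs, h⟩ := h
  refine PPFormula.isHigh_of_injective fun J _ _ hJ => (AddSubgroup.eq_top_iff' _).2 fun x => ?_
  obtain ⟨y, rfl⟩ := exists_smul_eq_of_injective hJ hs x
  exact h J y

theorem PPFormula.IsBounded.isLow [IsDomain R] {φ : PPFormula R} (h : φ.IsBounded) :
    φ.IsLow := by
  obtain ⟨r, hr, h⟩ := h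
  exact fun F _ _ hF => (AddSubgroup.eq_bot_iff_forall _).2 fun x hx =>
    hF.eq_zero_of_smul_eq_zero hr (h F x hx)

theorem PPFormula.IsCobounded.not_isBounded [IsDomain R] {φ : PPFormula R}
    (h : φ.IsCobounded) : ¬ φ.IsBounded := by
  rintro ⟨r, hr, hφ⟩
  obtain ⟨s, hs, h⟩ := h
  have := hφ R _ (h R 1)
  simp [hr, hs] at this

/-- In E(R) a bounding scalar would have to kill the image of 1. -/
theorem PPFormula.IsHigh.not_isBounded [IsDomain R] {φ : PPFormula R} (h : φ.IsHigh) :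
    ¬ φ.IsBounded := by
  rintro ⟨r, hr, hφ⟩
  obtain ⟨E, i, hi⟩ := exists_isInjectiveHull R R
  have h1 := hφ E (i 1) (by rw [h E (isAbsolutelyPure_of_injective hi.injective)]; trivial)
  rw [← map_smul, map_eq_zero_iff i hi.embedding] at h1
  exact hr (by simpa using h1)

end Pure

/-! ### Ore conditions against formulas that are both high and low. -/

section Ore

variable {R : Type u} [Ring R]

variable (R) in
-- Every tensor in A ⊗ R has the form a ⊗ 1, and f a can be read off its image. This makes R a test
-- module for low formulas.
theorem isFlat_self : IsFlat R R := by
  intro A B _ _ _ _ f hf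
  have hmk : ∀ t : BalancedTensor R A R, ∃ a : A, t = QuotientAddGroup.mk (a ⊗ₜ[ℤ] (1 : R)) := by
    intro t
    induction t using QuotientAddGroup.induction_on with
    | H t =>
      induction t using TensorProduct.induction_on with
      | zero => exact ⟨0, by simp⟩
      | tmul a r =>
        exact ⟨MulOpposite.op r • a, by rw [BalancedTensor.mk_op_smul_tmul, smul_eq_mul, mul_one]⟩
      | add t t' ht ht' =>
        obtain ⟨a, ha⟩ := ht
        obtain ⟨a', ha'⟩ := ht'
        exact ⟨a + a', by rw [QuotientAddGroup.mk_add, ha, ha', TensorProduct.add_tmul]; rfl⟩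
  let g : B →+ R →+ B :=
    AddMonoidHom.mk' (fun b => AddMonoidHom.mk' (fun r => MulOpposite.op r • b)
      fun r s => by rw [MulOpposite.op_add, add_smul])
      fun b b' => AddMonoidHom.ext fun r => smul_add _ b b'
  let l : BalancedTensor R B R →+ B :=
    BalancedTensor.lift g fun b r s => by simp [g, mul_smul]
  rw [injective_iff_map_eq_zero]
  intro t ht
  obtain ⟨a, rfl⟩ := hmk t
  have h1 : l (BalancedTensor.map R R f (QuotientAddGroup.mk (a ⊗ₜ[ℤ] (1 : R)))) =
    MulOpposite.op (1 : R) • f a := rfl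
  rw [ht, map_zero, MulOpposite.op_one, one_smul] at h1
  rw [(map_eq_zero_iff f hf).1 h1.symm, TensorProduct.zero_tmul]
  rfl

theorem exists_isInjectiveHull_injectiveHull (M : Type u) [AddCommGroup M] [Module R M] :
    ∃ i : M →ₗ[R] InjectiveHull R M, IsInjectiveHull i :=
  (exists_isInjectiveHull R M).choose_spec

theorem isFlatSharp_injectiveHull (M : Type u) [AddCommGroup M] [Module R M] [Nontrivial M]
    (h : IsFlat R (InjectiveHull R M)) : IsFlatSharp R (InjectiveHull R M) := by
  obtain ⟨i, hi⟩ := exists_isInjectiveHull_injectiveHull (R := R) M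
  exact ⟨hi.embedding.nontrivial, h, isAbsolutelyPure_of_injective hi.injective⟩

theorem isLeftOre_op_iff : IsLeftOre Rᵐᵒᵖ ↔ IsRightOre R := by
  constructor
  · intro h a b ha hb
    obtain ⟨c, d, hcd, h0⟩ := h (.op a) (.op b) (by simpa) (by simpa)
    exact ⟨c.unop, d.unop, congrArg MulOpposite.unop hcd,
      fun h => h0 (MulOpposite.unop_injective h)⟩
  · intro h a b ha hb
    obtain ⟨c, d, hcd, h0⟩ := h a.unop b.unop (by simpa) (by simpa)
    exact ⟨.op c, .op d, MulOpposite.unop_injective hcd,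
      fun h => h0 (congrArg MulOpposite.unop h)⟩

theorem isRightOre_op_iff : IsRightOre Rᵐᵒᵖ ↔ IsLeftOre R := by
  constructor
  · intro h a b ha hb
    obtain ⟨c, d, hcd, h0⟩ := h (.op a) (.op b) (by simpa) (by simpa)
    exact ⟨c.unop, d.unop, congrArg MulOpposite.unop hcd,
      fun h => h0 (MulOpposite.unop_injective h)⟩
  · intro h a b ha hb
    obtain ⟨c, d, hcd, h0⟩ := h a.unop b.unop (by simpa) (by simpa)
    exact ⟨.op c, .op d, MulOpposite.unop_injective hcd,
      fun h => h0 (congrArg MulOpposite.unop h)⟩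

variable [IsDomain R]

/-- Over a domain that is not left Ore, some formula `∃ y (a y = x ∧ b y = 0)` is high and low. -/
theorem exists_isHigh_isLow_of_not_isLeftOre (hR : ¬ IsLeftOre R) :
    ∃ φ : PPFormula R, φ.IsHigh ∧ φ.IsLow := by
  unfold IsLeftOre at hR
  push Not at hR
  obtain ⟨a, b, ha, hb, hab⟩ := hR
  refine ⟨⟨2, 1, fun i _ => ![a, b] i, ![1, 0]⟩, ?_, ?_⟩
  · refine PPFormula.isHigh_of_injective fun J _ _ hJ => (AddSubgroup.eq_top_iff' _).2 fun x => ?_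
    -- Since a, b are left independent, a ↦ x, b ↦ 0 extends to R → J; the witness y is the image of
    -- 1.
    let f : R × R →ₗ[R] R :=
      (LinearMap.toSpanSingleton R R a).coprod (LinearMap.toSpanSingleton R R b)
    have hf : Function.Injective f := by
      rw [injective_iff_map_eq_zero]
      rintro ⟨c, d⟩ hcd
      have hcd' : c * a = -d * b := by
        rw [neg_mul]
        exact eq_neg_of_add_eq_zero_left hcd
      have hca := hab c (-d) hcd'
      have hdb : d * b = 0 := by rw [hca, neg_mul] at hcd'; exact neg_eq_zero.1 hcd'.symm
      exact Prod.ext ((mul_eq_zero.1 hca).resolve_right ha) ((mul_eq_zero.1 hdb).resolve_right hb)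
    obtain ⟨h, hh⟩ := hJ.out f hf ((LinearMap.toSpanSingleton R J x).comp (LinearMap.fst R R R))
    have h1 : a • h 1 = x := by
      rw [← map_smul]
      simpa [f] using hh (1, 0)
    have h2 : b • h 1 = 0 := by
      rw [← map_smul]
      simpa [f] using hh (0, 1)
    refine ⟨fun _ => h 1, fun i => (Fin.sum_univ_one (fun _ : Fin 1 => _ • h 1)).trans ?_⟩
    revert i
    refine Fin.forall_fin_two.2 ⟨?_, ?_⟩
    · simpa using h1
    · simpa using h2
  · refine fun F _ _ hF => (AddSubgroup.eq_bot_iff_forall _).2 ?_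
    rintro x ⟨y, hy⟩
    have h1 : a • y (0 : Fin 1) = x := by
      have := (Fin.sum_univ_one (fun j : Fin 1 => a • y j)).symm.trans (hy (0 : Fin 2))
      simpa using this
    have h2 : b • y (0 : Fin 1) = 0 := by
      have := (Fin.sum_univ_one (fun j : Fin 1 => b • y j)).symm.trans (hy (1 : Fin 2))
      simpa using this
    rw [← h1, hF.eq_zero_of_smul_eq_zero hb h2, smul_zero]

/-- Over a domain that is not right Ore, some formula `∃ z (b z = a x)` is high and low. -/
theorem exists_isHigh_isLow_of_not_isRightOre (hR : ¬ IsRightOre R) :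
    ∃ φ : PPFormula R, φ.IsHigh ∧ φ.IsLow := by
  unfold IsRightOre at hR
  push Not at hR
  obtain ⟨a, b, ha, hb, hab⟩ := hR
  refine ⟨⟨1, 1, fun _ _ => b, fun _ => a⟩, ?_, ?_⟩
  -- Highness is mere divisibility by b; the failure of Ore enters only in lowness, as right
  -- independence of a, b.
  · refine PPFormula.isHigh_of_injective fun J _ _ hJ => (AddSubgroup.eq_top_iff' _).2 fun x => ?_
    obtain ⟨y, hy⟩ := exists_smul_eq_of_injective hJ hb (a • x)
    exact ⟨fun _ => y, fun _ => (Fin.sum_univ_one (fun _ : Fin 1 => b • y)).trans hy⟩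
  · refine fun F _ _ hF => (AddSubgroup.eq_bot_iff_forall _).2 ?_
    rintro x ⟨y, hy⟩
    have h1 := (Fin.sum_univ_one (fun j : Fin 1 => b • y j)).symm.trans (hy (0 : Fin 1))
    refine (hF.eq_zero_of_smul_eq_smul (fun c d hcd => ?_) h1.symm).1
    have hac := hab c d hcd
    exact ⟨(mul_eq_zero.1 hac).resolve_left ha,
      (mul_eq_zero.1 (hcd.symm.trans hac)).resolve_left hb⟩

theorem HasFlatSharp.isOre (h : HasFlatSharp R) : IsLeftOre R ∧ IsRightOre R := by
  obtain ⟨M, hM, hflat, hpure⟩ := h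
  have hno : ¬ ∃ φ : PPFormula R, φ.IsHigh ∧ φ.IsLow := by
    rintro ⟨φ, hhigh, hlow⟩
    have h1 := (hlow M hflat).symm.trans (hhigh M hpure)
    obtain ⟨x, hx⟩ := exists_ne (0 : M)
    have hx' : x ∈ (⊥ : AddSubgroup M) := h1 ▸ AddSubgroup.mem_top x
    exact hx hx'
  exact ⟨by_contra fun h => hno (exists_isHigh_isLow_of_not_isLeftOre h),
    by_contra fun h => hno (exists_isHigh_isLow_of_not_isRightOre h)⟩

theorem HasTwoRegions.not_exists_isHigh_isLow (h : HasTwoRegions R) :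
    ¬ ∃ φ : PPFormula R, φ.IsHigh ∧ φ.IsLow := by
  rintro ⟨φ, hhigh, hlow⟩
  obtain ⟨-, s, hs, hφ⟩ | ⟨-, hb⟩ := (h.1 φ).1
  · have h1 := hφ R 1
    rw [hlow R (isFlat_self R), smul_eq_mul, mul_one] at h1
    exact hs h1
  · exact hhigh.not_isBounded hb

/-! ### Ore elimination, the two regions and flat injective hulls. -/

/-- Over a two-sided Ore domain, a column `b` is, up to a nonzero right multiple, in the column
space of `A`, or some row vector annihilates `A` but not `b`. -/
theorem exists_solution_or_obstruction (hl : IsLeftOre R) (hr : IsRightOre R) {m : ℕ} :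
    ∀ {k : ℕ} (A : Matrix (Fin m) (Fin k) R) (b : Fin m → R),
      (∃ (s : R) (c : Fin k → R), s ≠ 0 ∧ ∀ i, ∑ j, A i j * c j = b i * s) ∨
      (∃ p : Fin m → R, (∀ j, ∑ i, p i * A i j = 0) ∧ ∑ i, p i * b i ≠ 0) := by
  intro k
  induction k with
  | zero =>
    intro A b
    by_cases hb : b = 0
    · exact Or.inl ⟨1, 0, one_ne_zero, fun i => by simp [hb]⟩
    · obtain ⟨i, hi⟩ := Function.ne_iff.1 hb
      exact Or.inr ⟨Pi.single i 1, fun j => j.elim0, by simpa [Pi.single_apply] using hi⟩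
  | succ k ih =>
    intro A b
    by_cases hA : ∀ i, A i 0 = 0
    · obtain ⟨s, c, hs, hc⟩ | ⟨p, hp, hpb⟩ := ih (fun i j => A i j.succ) b
      · exact Or.inl ⟨s, Fin.cons 0 c, hs, fun i => by simp [Fin.sum_univ_succ, hc]⟩
      · refine Or.inr ⟨p, fun j => ?_, hpb⟩
        cases j using Fin.cases with
        | zero => simp [hA]
        | succ j => exact hp j
    push Not at hA
    obtain ⟨i₀, hi₀⟩ := hA
    -- Left Ore clears the first column: row l becomes u l times row l minus v l times the pivot
    -- row.
    have huv : ∀ l, ∃ u v : R, u ≠ 0 ∧ u * A l 0 = v * A i₀ 0 := fun l => by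
      by_cases hl0 : A l 0 = 0
      · exact ⟨1, 0, one_ne_zero, by simp [hl0]⟩
      · obtain ⟨u, v, huv, h0⟩ := hl _ _ hl0 hi₀
        exact ⟨u, v, left_ne_zero_of_mul h0, huv⟩
    choose u v hu huv using huv
    obtain ⟨s, c, hs, hc⟩ | ⟨p, hp, hpb⟩ :=
      ih (fun l j => u l * A l j.succ - v l * A i₀ j.succ) (fun l => u l * b l - v l * b i₀)
    · left
      let w : Fin m → R := fun l => b l * s - ∑ j, A l j.succ * c j
      have hw : ∀ l, u l * w l = v l * w i₀ := fun l => by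
        have := hc l
        simp only [sub_mul, Finset.sum_sub_distrib, mul_assoc, ← Finset.mul_sum] at this
        simp only [w, mul_sub]
        refine sub_eq_zero.1 (Eq.trans ?_ (neg_eq_zero.2 (sub_eq_zero.2 this)))
        abel
      -- Right Ore solves the pivot row for the missing coordinate d, up to t; the other rows follow
      -- from `hw` by cancelling u l.
      have hdt : ∃ d t : R, t ≠ 0 ∧ A i₀ 0 * d = w i₀ * t := by
        by_cases hw0 : w i₀ = 0
        · exact ⟨0, 1, one_ne_zero, by simp [hw0]⟩
        · obtain ⟨d, t, hdt, h0⟩ := hr _ _ hi₀ hw0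
          exact ⟨d, t, right_ne_zero_of_mul (hdt ▸ h0), hdt⟩
      obtain ⟨d, t, ht, hdt⟩ := hdt
      refine ⟨s * t, Fin.cons d fun j => c j * t, mul_ne_zero hs ht, fun l => ?_⟩
      have hl' : A l 0 * d = w l * t := by
        apply mul_left_cancel₀ (hu l)
        rw [← mul_assoc, huv, mul_assoc, hdt, ← mul_assoc, ← hw, mul_assoc]
      simp only [Fin.sum_univ_succ, Fin.cons_zero, Fin.cons_succ, hl', w, sub_mul,
        ← mul_assoc, ← Finset.sum_mul]
      abel
    · right
      -- q is p times the matrix of the row operation.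
      let q : Fin m → R := fun l => p l * u l - if l = i₀ then ∑ i, p i * v i else 0
      have hq : ∀ x : Fin m → R, ∑ l, q l * x l = ∑ l, p l * (u l * x l - v l * x i₀) :=
        fun x => by
        simp [q, sub_mul, mul_sub, Finset.sum_sub_distrib, ite_mul, Finset.sum_mul, mul_assoc]
      refine ⟨q, fun j => ?_, by rwa [hq]⟩
      rw [hq]
      cases j using Fin.cases with
      | zero => simp [huv]
      | succ j => exact hp j

theorem PPFormula.isCobounded_or_isBounded (hl : IsLeftOre R) (hr : IsRightOre R)
    (φ : PPFormula R) : φ.IsCobounded ∨ φ.IsBounded := by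
  obtain ⟨s, c, hs, hc⟩ | ⟨p, hp, hpb⟩ := exists_solution_or_obstruction hl hr φ.A φ.b
  · refine Or.inl ⟨s, hs, fun M _ _ x => ⟨fun j => c j • x, fun i => ?_⟩⟩
    simp only [← mul_smul, ← Finset.sum_smul, hc]
  · refine Or.inr ⟨_, hpb, ?_⟩
    rintro M _ _ x ⟨y, hy⟩
    simp only [Finset.sum_smul, mul_smul, ← hy, Finset.smul_sum]
    rw [Finset.sum_comm]
    simp only [← mul_smul, ← Finset.sum_smul, hp, zero_smul, Finset.sum_const_zero]

theorem hasTwoRegions_of_isOre (hl : IsLeftOre R) (hr : IsRightOre R) : HasTwoRegions R := by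
  refine ⟨fun φ => ⟨?_, fun h => h.1.2.not_isBounded h.2.2⟩, fun r hr0 => ?_⟩
  · exact (φ.isCobounded_or_isBounded hl hr).imp (fun h => ⟨h.isHigh, h⟩) fun h => ⟨h.isLow, h⟩
  · have hd : (PPFormula.dvd r).IsCobounded :=
      ⟨r, hr0, fun M _ _ x => PPFormula.smul_mem_eval_dvd r x⟩
    have ha : (PPFormula.ann r).IsBounded :=
      ⟨r, hr0, fun M _ _ x => PPFormula.smul_eq_zero_of_mem_eval_ann⟩
    exact ⟨⟨hd.isHigh, hd⟩, ha.isLow, ha⟩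

/-- Over a two-sided Ore domain, the injective hull of a torsion-free module is flat. -/
theorem IsInjectiveHull.isFlat (hl : IsLeftOre R) (hr : IsRightOre R) {M E : Type u}
    [AddCommGroup M] [Module R M] [AddCommGroup E] [Module R E] {i : M →ₗ[R] E}
    (hi : IsInjectiveHull i) (hM : ∀ (r : R) (x : M), r ≠ 0 → r • x = 0 → x = 0) :
    IsFlat R E := by
  let T : Submodule R E :=
    { carrier := {e | ∃ r : R, r ≠ 0 ∧ r • e = 0}
      zero_mem' := ⟨1, one_ne_zero, smul_zero _⟩
      add_mem' := by
        rintro x y ⟨r, hr, hx⟩ ⟨s, hs, hy⟩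
        obtain ⟨c, d, hcd, h0⟩ := hl r s hr hs
        refine ⟨c * r, h0, ?_⟩
        rw [smul_add, mul_smul, hx, hcd, mul_smul, hy, smul_zero, smul_zero, add_zero]
      smul_mem' := by
        rintro a x ⟨r, hr, hx⟩
        by_cases ha : a = 0
        · exact ⟨1, one_ne_zero, by simp [ha]⟩
        obtain ⟨c, d, hcd, h0⟩ := hl a r ha hr
        exact ⟨c, left_ne_zero_of_mul h0, by rw [← mul_smul, hcd, mul_smul, hx, smul_zero]⟩ }
  -- Left Ore made the torsion elements a submodule; it misses M, so essentiality kills it.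
  have hT : T = ⊥ := by
    refine hi.essential T ((Submodule.eq_bot_iff _).2 ?_)
    rintro _ ⟨⟨r, hr, hx⟩, x, rfl⟩
    rw [← map_smul, map_eq_zero_iff i hi.embedding] at hx
    rw [hM r x hr hx, map_zero]
  refine hr.isFlat_of_bijective_smul fun s hs =>
    ⟨fun x y hxy => ?_, exists_smul_eq_of_injective hi.injective hs⟩
  have hmem : x - y ∈ T := ⟨s, hs, by rw [smul_sub]; exact sub_eq_zero.2 hxy⟩
  rw [hT] at hmem
  exact sub_eq_zero.1 hmem

end Ore

end PPMod

theorem mainTheorem3 (R : Type*) [Ring R] [IsDomain R] :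
    List.TFAE [
      PPMod.IsLeftOre R ∧ PPMod.IsRightOre R,
      PPMod.IsFlat R (PPMod.InjectiveHull R R),
      PPMod.IsFlat Rᵐᵒᵖ (PPMod.InjectiveHull Rᵐᵒᵖ R),
      PPMod.HasFlatSharp R ∨ PPMod.HasFlatSharp Rᵐᵒᵖ,
      PPMod.HasFlatSharp R ∧ PPMod.HasFlatSharp Rᵐᵒᵖ,
      (¬ ∃ φ : PPMod.PPFormula R, φ.IsHigh ∧ φ.IsLow) ∧
        (¬ ∃ φ : PPMod.PPFormula Rᵐᵒᵖ, φ.IsHigh ∧ φ.IsLow),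
      PPMod.HasTwoRegions R ∧ PPMod.HasTwoRegions Rᵐᵒᵖ] ∧
    (PPMod.IsFlat R (PPMod.InjectiveHull R R) →
      PPMod.IsFlatSharp R (PPMod.InjectiveHull R R)) ∧
    (PPMod.IsFlat Rᵐᵒᵖ (PPMod.InjectiveHull Rᵐᵒᵖ R) →
      PPMod.IsFlatSharp Rᵐᵒᵖ (PPMod.InjectiveHull Rᵐᵒᵖ R)) := by
  have hL := PPMod.isFlatSharp_injectiveHull (R := R) R
  have hR := PPMod.isFlatSharp_injectiveHull (R := Rᵐᵒᵖ) R
  refine ⟨?_, hL, hR⟩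
  tfae_have 1 → 2 := fun h => by
    obtain ⟨i, hi⟩ := PPMod.exists_isInjectiveHull_injectiveHull (R := R) R
    exact hi.isFlat h.1 h.2 fun r x hr hx => (mul_eq_zero.1 hx).resolve_left hr
  tfae_have 1 → 3 := fun h => by
    obtain ⟨i, hi⟩ := PPMod.exists_isInjectiveHull_injectiveHull (R := Rᵐᵒᵖ) R
    exact hi.isFlat (PPMod.isLeftOre_op_iff.2 h.2) (PPMod.isRightOre_op_iff.2 h.1)
      fun r x hr hx => (mul_eq_zero.1 hx).resolve_right
        fun h0 => hr (MulOpposite.unop_injective h0)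
  tfae_have 2 → 4 := fun h => Or.inl ⟨_, hL h⟩
  tfae_have 3 → 4 := fun h => Or.inr ⟨_, hR h⟩
  tfae_have 4 → 1 := by
    rintro (h | h)
    · exact h.isOre
    · exact ⟨PPMod.isRightOre_op_iff.1 h.isOre.2, PPMod.isLeftOre_op_iff.1 h.isOre.1⟩
  tfae_have 1 → 5 := fun h => ⟨⟨_, hL (tfae_1_to_2 h)⟩, ⟨_, hR (tfae_1_to_3 h)⟩⟩
  tfae_have 5 → 4 := fun h => Or.inl h.1
  tfae_have 1 → 7 := fun h => ⟨PPMod.hasTwoRegions_of_isOre h.1 h.2,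
    PPMod.hasTwoRegions_of_isOre (PPMod.isLeftOre_op_iff.2 h.2) (PPMod.isRightOre_op_iff.2 h.1)⟩
  tfae_have 7 → 6 := fun h => ⟨h.1.not_exists_isHigh_isLow, h.2.not_exists_isHigh_isLow⟩
  -- With formulas available on both sides, the formula for failure of left Ore suffices, used over
  -- R and over `Rᵐᵒᵖ`.
  tfae_have 6 → 1 := fun h =>
    ⟨by_contra fun h' => h.1 (PPMod.exists_isHigh_isLow_of_not_isLeftOre h'),
      by_contra fun h' => h.2 (PPMod.exists_isHigh_isLow_of_not_isLeftOre
        fun h'' => h' (PPMod.isLeftOre_op_iff.1 h''))⟩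
  tfae_finish
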